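/- Let $k\ge 2$. The \emph{infinite looped $k$-ary tree} is the infinite rooted tree in which every vertex has exactly $k$ children, ordered from left to right, together with a self-loop at the root, so that the root is regarded as its own parent and every vertex has degree $k+1$. In \emph{labeled chip-firing} on this tree, distinct chips labeled $1,2,\dots,N$ are placed on the vertices. A vertex $v$ holding at least $k+1$ chips can \emph{fire}: one chooses any $k+1$ of the chips on $v$, sends the $\lceil\frac{k+1}{2}\rceil$-th smallest of the chosen chips to the parent of $v$ (if $v$ is the root, this chip stays at the root), and, for $i=1,\dots,k$, sends the $i$-th smallest of the $k$ remaining chosen chips to the $i$-th leftmost child of $v$. A configuration (an assignment of a vertex to each chip) is \emph{stable} if no vertex can fire. For $\ell\ge 1$ put $N_{k,\ell}=\frac{k^\ell-1}{k-1}$, and let $Z_{k,\ell}$ be the number of distinct stable configurations that can be reached by sequences of firings from the configuration in which chips $1,2,\dots,N_{k,\ell}$ are all at the root. \textbf{Theorem.} For binary trees ($k=2$) and every integer $\ell\ge 3$, \[ Z_{2,\ell}\;\ge\; 6^{2^{\ell-3}}\prod_{j=4}^{\ell}\left(1+\left(\frac{N_{2,j}-1}{2}-2\right)^2\right)^{2^{\ell-j}},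 \] where the product is empty (equal to $1$) if $\ell=3$. -/

import Mathlib

/-!
Labeled chip-firing on the infinite rooted `k`-ary tree with a self-loop at the root.
-/

namespace LabeledChipFiring

/-- Vertices of the infinite rooted `k`-ary tree: words over `Fin k`. The root is the empty word
and the `i`-th leftmost child of `v` (counting from `0`) is `i :: v`. -/
abbrev Vertex (k : ℕ) : Type := List (Fin k)

/-- The root of the tree. -/
def root (k : ℕ) : Vertex k := []

/-- The `i`-th leftmost child of `v` (counting from `0`). -/
def child {k : ℕ} (v : Vertex k) (i : Fin k) : Vertex k := i :: v

/-- The parent of a vertex. The tail of the empty word is empty, so the root is its own parent: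
this is the self-loop at the root, and every vertex has degree `k + 1`. -/
def parent {k : ℕ} (v : Vertex k) : Vertex k := v.tail

/-- A configuration of chips, labeled by the elements of `C`, records the vertex of each chip. -/
abbrev Config (k : ℕ) (C : Type*) : Type _ := C → Vertex k

/-- Counting from `0`, the position of the `⌈(k + 1) / 2⌉`-th smallest of `k + 1` chips; indeed
`⌈(k + 1) / 2⌉ - 1 = ⌊k / 2⌋`. -/
def midIndex (k : ℕ) : Fin (k + 1) := ⟨k / 2, by omega⟩

/-- `FiresAt v σ τ`: the configuration `τ` arises from `σ` by one firing of the vertex `v`.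
Some `k + 1` chips `s 0 < s 1 < ⋯ < s k` on `v` are selected, the `⌈(k + 1) / 2⌉`-th smallest of
them goes to the parent of `v`, and of the `k` remaining selected chips the `i`-th smallest goes to
the `i`-th leftmost child of `v`. All other chips stay where they are.
(`(midIndex k).succAbove` enumerates the indices different from `midIndex k` increasingly.) -/
def FiresAt {k : ℕ} {C : Type*} [LinearOrder C] (v : Vertex k) (σ τ : Config k C) : Prop :=
  ∃ s : Fin (k + 1) ↪o C,
    (∀ i, σ (s i) = v) ∧
    τ (s (midIndex k)) = parent v ∧
    (∀ i : Fin k, τ (s ((midIndex k).succAbove i)) = child v i) ∧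
    ∀ c, c ∉ Set.range s → τ c = σ c

/-- One firing, of some vertex. -/
def Fires {k : ℕ} {C : Type*} [LinearOrder C] (σ τ : Config k C) : Prop :=
  ∃ v, FiresAt v σ τ

/-- A configuration is stable if no vertex can fire. -/
def IsStable {k : ℕ} {C : Type*} [LinearOrder C] (σ : Config k C) : Prop :=
  ∀ v, ¬ ∃ τ, FiresAt v σ τ

/-- The configuration with all chips on the root. -/
def initial (k : ℕ) (C : Type*) : Config k C := fun _ => root k

/-- The stable configurations that some sequence of firings reaches from all chips on the root. -/
def stableConfigs (k : ℕ) (C : Type*) [LinearOrder C] : Set (Config k C) :=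
  {τ | Relation.ReflTransGen Fires (initial k C) τ ∧ IsStable τ}

/-- The number of chips `N_{k,ℓ} = (k ^ ℓ - 1) / (k - 1)`; the division is exact for `k ≥ 2`. -/
def N (k ℓ : ℕ) : ℕ := (k ^ ℓ - 1) / (k - 1)

/-- `Z_{k,ℓ}`: the number of possible stable configurations from `N_{k,ℓ}` labeled chips on the
root (the chip with label `c + 1` is `c : Fin (N k ℓ)`). -/
noncomputable def Z (k ℓ : ℕ) : ℕ := (stableConfigs k (Fin (N k ℓ))).ncard

end LabeledChipFiring

/-! Write `M` for `N 2 ℓ`, so that `N 2 (ℓ + 1) = 2 * M + 1`. The bound is the unfolding of the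
recursion `B ↦ (1 + (M - 2) ^ 2) * B ^ 2` from `B = 6` at seven chips.

Firing the root `M` times can leave the median chip `r` there, with sets `L` and `R` of `M` chips on
its two children. Besides the plain split into smaller and larger chips, one of `M - 2` small chips
can be exchanged with one of `M - 2` large ones, whence `1 + (M - 2) ^ 2` splits (`isGoodSplit_Iio`,
`isGoodSplit_swap`).

Each subtree then imitates the looped tree on `M` chips (`Reach.join`). When both children of the
root have fired, their middle chips lie on the root on either side of `r`; firing these three
returns each to its child, just as a self-loop would. This consumes root firings of the two imitated
processes in pairs, so their numbers must agree: hence the count in `Reach` and the common `K` in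
`HasStable`. The final configuration determines the split and both subtree configurations, so all
choices are counted (`exists_finset_join`, `HasStable.step`). -/

namespace LabeledChipFiring

/-! ### Firings in the binary tree, counted at the root. -/

section Firing

variable {C : Type*} [LinearOrder C]

/-- The configuration after firing the chips `a < b < c` lying on a common vertex of the binary
tree. -/
def fire (σ : Config 2 C) (a b c : C) : Config 2 C := fun d =>
  if d = a then 0 :: σ b else if d = b then (σ b).tail else if d = c then 1 :: σ b else σ d

theorem firesAt_fire {σ : Config 2 C} {a b c : C} (hab : a < b) (hbc : b < c)
    (ha : σ a = σ b) (hc : σ c = σ b) : FiresAt (σ b) σ (fire σ a b c) := by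
  have hm : StrictMono ![a, b, c] := by
    rw [Fin.strictMono_iff_lt_succ]
    intro i
    fin_cases i <;> simpa
  refine ⟨OrderEmbedding.ofStrictMono _ hm, ?_, ?_, ?_, ?_⟩
  · intro i
    fin_cases i <;> simp [ha, hc]
  · have : midIndex 2 = 1 := rfl
    simp [this, fire, hab.ne', parent]
  · intro i
    have h0 : (midIndex 2).succAbove 0 = 0 := rfl
    have h1 : (midIndex 2).succAbove 1 = 2 := rfl
    fin_cases i
    · simp [h0, fire, child]
    · simp [h1, fire, child, hbc.ne', (hab.trans hbc).ne']
  · intro d hd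
    have h : ∀ i, ![a, b, c] i ≠ d := fun i hi => hd ⟨i, hi⟩
    have h0 := h 0
    have h1 := h 1
    have h2 := h 2
    simp at h0 h1 h2
    simp [fire, Ne.symm h0, Ne.symm h1, Ne.symm h2]

theorem FiresAt.exists_eq_fire {v : Vertex 2} {σ τ : Config 2 C} (h : FiresAt v σ τ) :
    ∃ a b c, a < b ∧ b < c ∧ σ a = σ b ∧ σ c = σ b ∧ τ = fire σ a b c := by
  obtain ⟨s, hs, hm, hch, ho⟩ := h
  refine ⟨s 0, s 1, s 2, by simp, by simp, by rw [hs, hs], by rw [hs, hs], ?_⟩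
  have h0 : τ (s 0) = 0 :: v := hch 0
  have h1 : τ (s 1) = v.tail := hm
  have h2 : τ (s 2) = 1 :: v := hch 1
  funext d
  unfold fire
  rw [hs 1]
  split_ifs with e0 e1 e2
  · rw [e0, h0]
  · rw [e1, h1]
  · rw [e2, h2]
  · refine ho d ?_
    rintro ⟨i, rfl⟩
    fin_cases i <;> simp_all

theorem isStable_of_injective {σ : Config 2 C} (h : Function.Injective σ) : IsStable σ := by
  rintro v ⟨τ, hτ⟩
  obtain ⟨a, b, c, hab, -, ha, -⟩ := hτ.exists_eq_fire
  exact hab.ne (h ha)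

/-- `Reach n σ τ`: some sequence of firings with exactly `n` firings of the root leads from `σ`
to `τ`. -/
inductive Reach : ℕ → Config 2 C → Config 2 C → Prop
  | refl (σ : Config 2 C) : Reach 0 σ σ
  | inner {n : ℕ} {σ τ : Config 2 C} {a b c : C} (h : Reach n σ τ) (hab : a < b) (hbc : b < c)
      (ha : τ a = τ b) (hc : τ c = τ b) (hb : τ b ≠ []) : Reach n σ (fire τ a b c)
  | root {n : ℕ} {σ τ : Config 2 C} {a b c : C} (h : Reach n σ τ) (hab : a < b) (hbc : b < c)
      (ha : τ a = []) (hb : τ b = []) (hc : τ c = []) : Reach (n + 1) σ (fire τ a b c)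

theorem Reach.trans {m n : ℕ} {σ τ ρ : Config 2 C} (h : Reach m σ τ) (h' : Reach n τ ρ) :
    Reach (m + n) σ ρ := by
  induction h' with
  | refl => exact h
  | inner _ hab hbc ha hc hb ih => exact (ih h).inner hab hbc ha hc hb
  | root _ hab hbc ha hb hc ih => exact (ih h).root hab hbc ha hb hc

theorem Reach.reflTransGen {n : ℕ} {σ τ : Config 2 C} (h : Reach n σ τ) :
    Relation.ReflTransGen Fires σ τ := by
  induction h with
  | refl => exact .refl
  | inner _ hab hbc ha hc hb ih => exact ih.tail ⟨_, firesAt_fire hab hbc ha hc⟩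
  | root _ hab hbc ha hb hc ih =>
    exact ih.tail ⟨_, firesAt_fire hab hbc (ha.trans hb.symm) (hc.trans hb.symm)⟩

/-- Check a list of firings, counting those of the root. -/
def runFirings (σ : Config 2 C) : List (C × C × C) → Option (ℕ × Config 2 C)
  | [] => some (0, σ)
  | (a, b, c) :: l =>
    if a < b ∧ b < c ∧ σ a = σ b ∧ σ c = σ b then
      (runFirings (fire σ a b c) l).map fun p => ((if σ b = [] then 1 else 0) + p.1, p.2)
    else none

theorem reach_of_runFirings {σ τ : Config 2 C} {n : ℕ} {l : List (C × C × C)}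
    (h : runFirings σ l = some (n, τ)) : Reach n σ τ := by
  induction l generalizing σ τ n with
  | nil =>
    simp only [runFirings, Option.some.injEq, Prod.mk.injEq] at h
    obtain ⟨rfl, rfl⟩ := h
    exact .refl _
  | cons x l ih =>
    obtain ⟨a, b, c⟩ := x
    rw [runFirings] at h
    by_cases hx : a < b ∧ b < c ∧ σ a = σ b ∧ σ c = σ b
    swap
    · simp [if_neg hx] at h
    rw [if_pos hx] at h
    obtain ⟨hab, hbc, ha, hc⟩ := hx
    rw [Option.map_eq_some_iff] at h
    obtain ⟨⟨m, ρ⟩, hm, he⟩ := h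
    simp only [Prod.mk.injEq] at he
    obtain ⟨rfl, rfl⟩ := he
    by_cases hb : σ b = []
    · rw [if_pos hb]
      simpa using ((Reach.refl σ).root hab hbc (ha.trans hb) hb (hc.trans hb)).trans (ih hm)
    · rw [if_neg hb]
      exact ((Reach.refl σ).inner hab hbc ha hc hb).trans (ih hm)

/-- Fire the root repeatedly with `r` as the middle chip. -/
theorem reach_of_pairs (r : C) (σ : Config 2 C) (hr : σ r = []) (n : ℕ) (A B : Finset C)
    (hA : A.card = n) (hB : B.card = n) (hAr : ∀ a ∈ A, a < r) (hBr : ∀ b ∈ B, r < b)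
    (hA0 : ∀ a ∈ A, σ a = []) (hB0 : ∀ b ∈ B, σ b = []) :
    Reach n σ (fun c => if c ∈ A then [0] else if c ∈ B then [1] else σ c) := by
  induction n generalizing A B with
  | zero =>
    rw [Finset.card_eq_zero] at hA hB
    subst hA hB
    simpa using Reach.refl σ
  | succ n ih =>
    obtain ⟨a, A, haA, rfl, hA'⟩ := Finset.card_eq_succ.1 hA
    obtain ⟨b, B, hbB, rfl, hB'⟩ := Finset.card_eq_succ.1 hB
    simp only [Finset.forall_mem_insert] at hAr hBr hA0 hB0
    have hrA : r ∉ A := fun h => lt_irrefl _ (hAr.2 r h)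
    have hrB : r ∉ B := fun h => lt_irrefl _ (hBr.2 r h)
    have haB : a ∉ B := fun h => lt_asymm hAr.1 (hBr.2 a h)
    have hbA : b ∉ A := fun h => lt_asymm hBr.1 (hAr.2 b h)
    have := (ih A B hA' hB' hAr.2 hBr.2 hA0.2 hB0.2).root hAr.1 hBr.1
      (by simp [haA, haB, hA0.1]) (by simp [hrA, hrB, hr]) (by simp [hbA, hbB, hB0.1])
    convert this using 1
    funext d
    unfold fire
    by_cases hda : d = a
    · simp [hda, hrA, hrB, hr]
    by_cases hdr : d = r
    · subst hdr
      simp [hda, hrA, hrB, hr, hBr.1.ne]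
    by_cases hdb : d = b
    · subst hdb
      simp [hda, hrA, hrB, hr, hdr, hbA]
    simp [hda, hdr, hdb]

end Firing

/-! ### Finiteness of the set of reachable stable configurations. -/

section Finiteness

variable {C : Type*} [LinearOrder C]

/-- Whenever a child of a vertex has a chip weakly below it, so does its sibling. -/
def Balanced (σ : Config 2 C) : Prop :=
  ∀ (u : Vertex 2) (i j : Fin 2), (∃ d, i :: u <:+ σ d) → ∃ d, j :: u <:+ σ d

theorem Balanced.fire {σ : Config 2 C} (h : Balanced σ) {a b c : C} (hab : a < b) (hbc : b < c)
    (ha : σ a = σ b) (hc : σ c = σ b) : Balanced (fire σ a b c) := by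
  have ea : LabeledChipFiring.fire σ a b c a = 0 :: σ b := by simp [LabeledChipFiring.fire]
  have ec : LabeledChipFiring.fire σ a b c c = 1 :: σ b := by
    simp [LabeledChipFiring.fire, hbc.ne', (hab.trans hbc).ne']
  intro u i j hi
  by_cases hu : u = σ b
  · subst hu
    fin_cases j
    · exact ⟨a, by simp [ea]⟩
    · exact ⟨c, by simp [ec]⟩
  -- Away from the children of the fired vertex, a firing never brings a first chip into a subtree.
  have back : ∃ d, i :: u <:+ σ d := by
    obtain ⟨d, hd⟩ := hi
    unfold LabeledChipFiring.fire at hd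
    split_ifs at hd
    · rw [List.suffix_cons_iff] at hd
      rcases hd with hd | hd
      · exact absurd (List.cons.inj hd).2 hu
      · exact ⟨b, hd⟩
    · exact ⟨b, hd.trans (List.tail_suffix _)⟩
    · rw [List.suffix_cons_iff] at hd
      rcases hd with hd | hd
      · exact absurd (List.cons.inj hd).2 hu
      · exact ⟨b, hd⟩
    · exact ⟨d, hd⟩
  obtain ⟨d, hd⟩ := h u i j back
  -- The witness `d` may itself be fired; then `a`, moving to a child of that vertex, replaces it.
  by_cases hdw : σ d = σ b
  · exact ⟨a, by rw [ea, ← hdw]; exact hd.trans (List.suffix_cons _ _)⟩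
  · refine ⟨d, ?_⟩
    have h1 : d ≠ a := by rintro rfl; exact hdw ha
    have h2 : d ≠ b := by rintro rfl; exact hdw rfl
    have h3 : d ≠ c := by rintro rfl; exact hdw hc
    simpa [LabeledChipFiring.fire, h1, h2, h3] using hd

theorem balanced_of_reflTransGen {σ : Config 2 C}
    (h : Relation.ReflTransGen Fires (initial 2 C) σ) : Balanced σ := by
  induction h with
  | refl =>
    rintro u i j ⟨d, hd⟩
    simp [initial, root] at hd
  | tail _ hf ih =>
    obtain ⟨v, hv⟩ := hf
    obtain ⟨a, b, c, hab, hbc, ha, hc, rfl⟩ := hv.exists_eq_fire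
    exact ih.fire hab hbc ha hc

/-- Every edge on the path from `v` down to `c` has a sibling subtree containing a further chip, and
these subtrees are disjoint. Depth is thus bounded by the number of chips. -/
theorem Balanced.length_lt_card [Fintype C] {σ : Config 2 C} (h : Balanced σ)
    (p v : Vertex 2) (c : C) (hc : σ c = p ++ v) :
    p.length + 1 ≤ (Finset.univ.filter fun d => v <:+ σ d).card := by
  induction p using List.reverseRecOn generalizing v with
  | nil =>
    simp only [List.length_nil, zero_add]
    exact Finset.card_pos.2 ⟨c, by simp [hc]⟩
  | append_singleton q i ih =>
    have hc' : σ c = q ++ (i :: v) := by simp [hc]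
    obtain ⟨j, hj⟩ : ∃ j : Fin 2, j ≠ i := exists_ne i
    obtain ⟨d, hd⟩ := h v i j ⟨c, by rw [hc']; exact List.suffix_append _ _⟩
    have hdi : ¬ i :: v <:+ σ d := by
      intro hi
      have : j :: v = i :: v := by
        refine List.IsSuffix.eq_of_length ?_ rfl
        exact List.suffix_of_suffix_length_le hd hi le_rfl
      exact hj (List.cons.inj this).1
    calc (q ++ [i]).length + 1 = (q.length + 1) + 1 := by simp
      _ ≤ (Finset.univ.filter fun d => i :: v <:+ σ d).card + 1 := by
        exact Nat.add_le_add_right (ih _ hc') 1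
      _ = (insert d (Finset.univ.filter fun d => i :: v <:+ σ d)).card := by
        rw [Finset.card_insert_of_notMem (by simpa using hdi)]
      _ ≤ _ := by
        refine Finset.card_le_card fun e he => ?_
        simp only [Finset.mem_insert, Finset.mem_filter, Finset.mem_univ, true_and] at he ⊢
        rcases he with rfl | he
        · exact (List.suffix_cons _ _).trans hd
        · exact (List.suffix_cons _ _).trans he

/-- Needed because `Set.ncard` is `0` on infinite sets, where a lower bound would fail. -/
theorem finite_stableConfigs [Fintype C] : (stableConfigs 2 C).Finite := by
  have hf : (Set.univ.pi fun _ : C => {l : Vertex 2 | l.length ≤ Fintype.card C}).Finite :=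
    Set.Finite.pi fun _ => List.finite_length_le _ _
  refine hf.subset fun σ hσ c _ => ?_
  have h1 := (balanced_of_reflTransGen hσ.1).length_lt_card (σ c) [] c (by simp)
  have h2 := Finset.card_le_univ (Finset.univ.filter fun d => [] <:+ σ d)
  simp only [Set.mem_ofPred_eq]
  omega

end Finiteness

/-! ### Running two processes side by side in the subtrees of the root. -/

section Join

variable {C D : Type*} [LinearOrder C] [LinearOrder D]

/-- `σ` consists of the chip `r` on the root, the configuration `σL` in the left subtree and the
configuration `σR` in the right subtree. -/
structure IsJoin (r : C) (eL eR : D ↪o C) (σ : Config 2 C) (σL σR : Config 2 D) : Prop where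
  mid : σ r = []
  left : ∀ x, σ (eL x) = σL x ++ [0]
  right : ∀ x, σ (eR x) = σR x ++ [1]

/-- The chips in the images of `eL` and `eR` and the chip `r` are distinct; in the left part only
the largest chip may exceed `r` and in the right part only the smallest one may be below `r`. -/
structure IsSplit (r : C) (eL eR : D ↪o C) : Prop where
  left_ne : ∀ x, eL x ≠ r
  right_ne : ∀ x, eR x ≠ r
  left_ne_right : ∀ x y, eL x ≠ eR y
  left_lt : ∀ x y, x < y → eL x < r
  lt_right : ∀ x y, x < y → r < eR y

variable {r : C} {eL eR : D ↪o C} {σ : Config 2 C} {σL σR : Config 2 D}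

/-- Away from the subtree's root, `tail` commutes with appending `[0]`; at that root it does not,
since the middle chip leaves the subtree. -/
theorem IsJoin.fire_left (hs : IsSplit r eL eR) (h : IsJoin r eL eR σ σL σR) {a b c : D}
    (hb : σL b ≠ []) :
    IsJoin r eL eR (fire σ (eL a) (eL b) (eL c)) (fire σL a b c) σR where
  mid := by simp [fire, (hs.left_ne _).symm, h.mid]
  left x := by
    simp only [fire, EmbeddingLike.apply_eq_iff_eq, h.left]
    split_ifs <;> simp [List.tail_append_of_ne_nil, hb]
  right x := by simp [fire, (hs.left_ne_right _ _).symm, h.right]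

theorem IsJoin.fire_right (hs : IsSplit r eL eR) (h : IsJoin r eL eR σ σL σR) {a b c : D}
    (hb : σR b ≠ []) :
    IsJoin r eL eR (fire σ (eR a) (eR b) (eR c)) σL (fire σR a b c) where
  mid := by simp [fire, (hs.right_ne _).symm, h.mid]
  right x := by
    simp only [fire, EmbeddingLike.apply_eq_iff_eq, h.right]
    split_ifs <;> simp [List.tail_append_of_ne_nil, hb]
  left x := by simp [fire, (hs.left_ne_right _ _), h.left]

theorem IsJoin.reach_root (hs : IsSplit r eL eR) (h : IsJoin r eL eR σ σL σR)
    {a b c a' b' c' : D} (hab : a < b) (hbc : b < c) (hab' : a' < b') (hbc' : b' < c')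
    (ha : σL a = []) (hb : σL b = []) (hc : σL c = [])
    (ha' : σR a' = []) (hb' : σR b' = []) (hc' : σR c' = []) :
    ∃ τ, Reach 1 σ τ ∧ IsJoin r eL eR τ (fire σL a b c) (fire σR a' b' c') := by
  have l1 := hs.left_ne
  have l2 := hs.right_ne
  have l3 := hs.left_ne_right
  have l1' := fun x => (hs.left_ne x).symm
  have l2' := fun x => (hs.right_ne x).symm
  have l3' := fun x y => (hs.left_ne_right x y).symm
  have h1 := (Reach.refl σ).inner (a := eL a) (b := eL b) (c := eL c) (by simpa) (by simpa)
    (by simp [h.left, ha, hb]) (by simp [h.left, hc, hb]) (by simp [h.left])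
  have h2 := h1.inner (a := eR a') (b := eR b') (c := eR c') (by simpa) (by simpa)
    (by simp [fire, l3', h.right, ha', hb']) (by simp [fire, l3', h.right, hc', hb'])
    (by simp [fire, l3', h.right])
  -- `b` is not the largest left chip and `a' < b'`, so `IsSplit` puts `eL b` and `eR b'` on
  -- opposite sides of `r` even after an exchange.
  have h3 := h2.root (a := eL b) (b := r) (c := eR b') (hs.left_lt b c hbc)
    (hs.lt_right a' b' hab')
    (by simp [fire, l3, h.left, hb, hab.ne'])
    (by simp [fire, l1', l2', h.mid])
    (by simp [fire, l3', h.right, hb', hab'.ne'])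
  refine ⟨_, h3, ?_, ?_, ?_⟩
  · simp [fire, l1', l2', h.mid]
  · intro x
    by_cases hxa : x = a
    · subst hxa
      simp [fire, l1, l3, h.left, hb, hab.ne]
    by_cases hxb : x = b
    · subst hxb
      simp [fire, l1', l2', h.mid, hb, hab.ne']
    simp [fire, l1, l3, h.left, hb, hxa, hxb]
    split_ifs <;> simp
  · intro x
    by_cases hxa : x = a'
    · subst hxa
      simp [fire, l2, l3', h.right, hb', hab'.ne]
    by_cases hxb : x = b'
    · subst hxb
      simp [fire, l2, l1', l2', l3', h.mid, hb', hab'.ne']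
    simp [fire, l2, l3', h.right, hb', hxa, hxb]
    split_ifs <;> simp

/-- Firings in the two subtrees with equally many firings of both children of the root can be
interleaved, the root acting as the parent of each of its children in turn. -/
theorem Reach.join (hs : IsSplit r eL eR) {n : ℕ} {τL τR : Config 2 D} (hL : Reach n σL τL)
    (hR : Reach n σR τR) (h : IsJoin r eL eR σ σL σR) :
    ∃ τ, Reach n σ τ ∧ IsJoin r eL eR τ τL τR := by
  have right_step : ∀ {m : ℕ} {ρL ρR : Config 2 D} {a b c : D},
      (∃ τ, Reach m σ τ ∧ IsJoin r eL eR τ ρL ρR) → a < b → b < c → ρR a = ρR b →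
      ρR c = ρR b → ρR b ≠ [] → ∃ τ, Reach m σ τ ∧ IsJoin r eL eR τ ρL (fire ρR a b c) := by
    rintro m ρL ρR a b c ⟨τ, hτ, hj⟩ hab hbc ha hc hb
    exact ⟨_, hτ.inner (a := eR a) (b := eR b) (c := eR c) (by simpa) (by simpa)
      (by simp [hj.right, ha]) (by simp [hj.right, hc]) (by simp [hj.right]),
      hj.fire_right hs hb⟩
  induction hL generalizing τR with
  | refl =>
    generalize hm : 0 = m at hR
    induction hR with
    | refl => exact ⟨σ, .refl _, h⟩
    | inner _ hab hbc ha hc hb ih => exact right_step (ih h hm) hab hbc ha hc hb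
    | root => omega
  | inner _ hab hbc ha hc hb ih =>
    obtain ⟨τ, hτ, hj⟩ := ih hR h
    exact ⟨_, hτ.inner (by simpa) (by simpa)
      (by simp [hj.left, ha]) (by simp [hj.left, hc]) (by simp [hj.left]),
      hj.fire_left hs hb⟩
  | @root k _ ρL a b c _ hab hbc ha hb hc ih =>
    -- The left process ends with a root firing: peel inner firings off the right one until it does
    -- too, then perform both together.
    generalize hm : k + 1 = m at hR
    induction hR with
    | refl => omega
    | inner _ hab hbc ha hc hb ih' => exact right_step (ih' ih h hm) hab hbc ha hc hb
    | root hR' hab' hbc' ha' hb' hc' _ =>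
      obtain rfl := Nat.succ_injective hm
      obtain ⟨τ, hτ, hj⟩ := ih hR' h
      obtain ⟨ρ, hρ, hj'⟩ := hj.reach_root hs hab hbc hab' hbc' ha hb hc ha' hb' hc'
      exact ⟨ρ, hτ.trans hρ, hj'⟩

theorem IsJoin.injective (h : IsJoin r eL eR σ σL σR)
    (hcover : ∀ c, c = r ∨ c ∈ Set.range eL ∨ c ∈ Set.range eR)
    (hL : Function.Injective σL) (hR : Function.Injective σR) : Function.Injective σ := by
  intro c d hcd
  rcases hcover c with rfl | ⟨x, rfl⟩ | ⟨x, rfl⟩ <;>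
  rcases hcover d with rfl | ⟨y, rfl⟩ | ⟨y, rfl⟩ <;>
  simp [h.mid, h.left, h.right] at hcd ⊢
  · exact hL hcd
  · exact hR hcd

theorem IsJoin.mem_range_left_iff (h : IsJoin r eL eR σ σL σR)
    (hcover : ∀ c, c = r ∨ c ∈ Set.range eL ∨ c ∈ Set.range eR) (c : C) :
    c ∈ Set.range eL ↔ [0] <:+ σ c := by
  constructor
  · rintro ⟨x, rfl⟩
    simp [h.left]
  · intro hc
    rcases hcover c with rfl | hx | ⟨x, rfl⟩
    · simp [h.mid] at hc
    · exact hx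
    · rw [h.right] at hc
      simp at hc

end Join

/-! ### Initial splits, and counting the joined configurations. -/

section Counting

variable {C : Type*} [LinearOrder C]

/-- The chips of `L` on the left child of the root, those of `R` on the right child, and the
others on the root. -/
def splitConfig (L R : Finset C) : Config 2 C := fun c =>
  if c ∈ L then [0] else if c ∈ R then [1] else []

/-- Two initial firings put the small chip `i` on the right and the large chip `j` on the left. -/
theorem reach_splitConfig_swap {n : ℕ} {a b i r j y z : C} (hab : a < b) (hbi : b < i)
    (hir : i < r) (hrj : r < j) (hjy : j < y) (hyz : y < z) (A B : Finset C)
    (hA : A.card = n) (hB : B.card = n) (hAr : ∀ x ∈ A, x < r) (hBr : ∀ x ∈ B, r < x)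
    (haA : a ∉ A) (hiA : i ∉ A) (hjB : j ∉ B) (hzB : z ∉ B) :
    Reach (n + 2) (initial 2 C)
      (splitConfig (insert a (insert j A)) (insert z (insert i B))) := by
  have hai := hab.trans hbi
  have har := hai.trans hir
  have hjz := hjy.trans hyz
  have hrz := hrj.trans hjz
  -- As the largest of `a < b < i`, chip `i` goes right; below, `j` goes left as the smallest of `j
  -- < y < z`. The middle chips `b` and `y` stay on the root.
  have h1 := (Reach.refl (initial 2 C)).root hab hbi rfl rfl rfl
  have e : ∀ x, r ≤ x → fire (initial 2 C) a b i x = [] := by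
    intro x hx
    simp [fire, initial, root, (har.trans_le hx).ne', (hir.trans_le hx).ne']
  have h2 := h1.root hjy hyz (e j hrj.le) (e y (hrj.trans hjy).le) (e z hrz.le)
  have hjA : j ∉ A := fun h => lt_asymm hrj (hAr j h)
  have hzA : z ∉ A := fun h => lt_asymm hrz (hAr z h)
  have haB : a ∉ B := fun h => lt_asymm har (hBr a h)
  have hiB : i ∉ B := fun h => lt_asymm hir (hBr i h)
  have hval : ∀ x, fire (fire (initial 2 C) a b i) j y z x =
      if x = a ∨ x = j then [0] else if x = i ∨ x = z then [1] else [] := by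
    intro x
    rw [fire, e y (hrj.trans hjy).le]
    by_cases hxj : x = j
    · simp [hxj]
    by_cases hxy : x = y
    · subst hxy
      simp [hjy.ne', hyz.ne, (har.trans (hrj.trans hjy)).ne', (hir.trans (hrj.trans hjy)).ne']
    by_cases hxz : x = z
    · subst hxz
      simp [hxj, hxy, (har.trans hrz).ne']
    simp only [hxj, hxy, hxz, fire, initial, root]
    by_cases hxb : x = b <;> simp [hxb, hab.ne', hbi.ne]
  have h3 := reach_of_pairs r (fire (fire (initial 2 C) a b i) j y z)
    (by simp [hval, har.ne', hrj.ne, hir.ne', hrz.ne]) n A B hA hB hAr hBr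
    (fun x hx => by
      rw [hval, if_neg, if_neg] <;> rintro (rfl | rfl) <;> contradiction)
    (fun x hx => by
      rw [hval, if_neg, if_neg] <;> rintro (rfl | rfl) <;> contradiction)
  have h4 := h2.trans h3
  rw [show 0 + 1 + 1 + n = n + 2 by omega] at h4
  convert h4 using 1
  funext x
  simp only [splitConfig, Finset.mem_insert, hval]
  by_cases hxa : x = a
  · simp [hxa, haA, haB]
  by_cases hxj : x = j
  · simp [hxj, hjA, hjB]
  by_cases hxi : x = i
  · subst hxi
    simp [hxa, hxj, hiA, hiB]
  by_cases hxz : x = z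
  · subst hxz
    simp [hxa, hxj, hzA, hzB]
  simp [hxa, hxj, hxi, hxz]

/-- The conditions on the sets of chips sent to the left and right subtrees under which the two
subtrees can be stabilized independently. -/
structure IsGoodSplit (r : C) (M : ℕ) (L R : Finset C) : Prop where
  card_left : L.card = M
  card_right : R.card = M
  disjoint : ∀ x ∈ L, x ∉ R
  notMem_left : r ∉ L
  notMem_right : r ∉ R
  cover : ∀ c, c = r ∨ c ∈ L ∨ c ∈ R
  left_lt : ∀ x ∈ L, ∀ y ∈ L, x < y → x < r
  lt_right : ∀ x ∈ R, ∀ y ∈ R, x < y → r < y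
  reach : Reach M (initial 2 C) (splitConfig L R)

theorem IsGoodSplit.exists_join {r : C} {M K : ℕ} {L R : Finset C} (h : IsGoodSplit r M L R)
    {τL τR : Config 2 (Fin M)} (hL : Reach K (initial 2 (Fin M)) τL)
    (hR : Reach K (initial 2 (Fin M)) τR) (hLi : Function.Injective τL)
    (hRi : Function.Injective τR) :
    ∃ τ, Reach (M + K) (initial 2 C) τ ∧ Function.Injective τ ∧ (∀ c, c ∈ L ↔ [0] <:+ τ c) ∧
      IsJoin r (L.orderEmbOfFin h.card_left) (R.orderEmbOfFin h.card_right) τ τL τR := by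
  have mL : ∀ x, L.orderEmbOfFin h.card_left x ∈ L := fun x => L.orderEmbOfFin_mem _ x
  have mR : ∀ x, R.orderEmbOfFin h.card_right x ∈ R := fun x => R.orderEmbOfFin_mem _ x
  have hs : IsSplit r (L.orderEmbOfFin h.card_left) (R.orderEmbOfFin h.card_right) := by
    refine ⟨?_, ?_, ?_, ?_, ?_⟩
    · intro x hx
      exact h.notMem_left (hx ▸ mL x)
    · intro x hx
      exact h.notMem_right (hx ▸ mR x)
    · intro x y hxy
      exact h.disjoint _ (mL x) (hxy ▸ mR y)
    · intro x y hxy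
      exact h.left_lt _ (mL x) _ (mL y) (by simpa)
    · intro x y hxy
      exact h.lt_right _ (mR x) _ (mR y) (by simpa)
  have hj : IsJoin r (L.orderEmbOfFin h.card_left) (R.orderEmbOfFin h.card_right)
      (splitConfig L R) (initial 2 (Fin M)) (initial 2 (Fin M)) := by
    refine ⟨?_, ?_, ?_⟩
    · simp [splitConfig, h.notMem_left, h.notMem_right]
    · intro x
      simp [splitConfig, initial, root]
    · intro x
      have : R.orderEmbOfFin h.card_right x ∉ L := fun hx => h.disjoint _ hx (mR x)
      simp [splitConfig, this, initial, root]
  obtain ⟨τ, hτ, hjτ⟩ := hL.join hs hR hj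
  have hcover : ∀ c, c = r ∨ c ∈ Set.range (L.orderEmbOfFin h.card_left) ∨
      c ∈ Set.range (R.orderEmbOfFin h.card_right) := by
    simpa using h.cover
  refine ⟨τ, h.reach.trans hτ, hjτ.injective hcover hLi hRi, fun c => ?_, hjτ⟩
  rw [← hjτ.mem_range_left_iff hcover]
  simp

/-- `L i` is recovered as the set of chips ending below the left child; `i` then fixes the
embeddings, through which both subtree configurations are read off. -/
theorem exists_finset_join {ι : Type*} [Fintype ι] {r : C} {M K : ℕ} {L R : ι → Finset C}
    (h : ∀ i, IsGoodSplit r M (L i) (R i)) (hinj : Function.Injective L)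
    (S : Finset (Config 2 (Fin M)))
    (hS : ∀ τ ∈ S, Reach K (initial 2 (Fin M)) τ ∧ Function.Injective τ) :
    ∃ T : Finset (Config 2 C), T.card = Fintype.card ι * S.card ^ 2 ∧
      ∀ τ ∈ T, Reach (M + K) (initial 2 C) τ ∧ Function.Injective τ := by
  classical
  have key : ∀ p : ι × S × S, ∃ τ, Reach (M + K) (initial 2 C) τ ∧ Function.Injective τ ∧
      (∀ c, c ∈ L p.1 ↔ [0] <:+ τ c) ∧
      IsJoin r ((L p.1).orderEmbOfFin (h p.1).card_left)
        ((R p.1).orderEmbOfFin (h p.1).card_right) τ p.2.1 p.2.2 := fun p =>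
    (h p.1).exists_join (hS _ p.2.1.2).1 (hS _ p.2.2.2).1 (hS _ p.2.1.2).2 (hS _ p.2.2.2).2
  choose f hf1 hf2 hf3 hf4 using key
  have hfi : Function.Injective f := by
    intro p q hpq
    obtain ⟨i, σ, τ⟩ := p
    obtain ⟨j, σ', τ'⟩ := q
    obtain rfl : i = j := hinj (Finset.ext fun c => by
      rw [hf3 (i, σ, τ) c, hf3 (j, σ', τ') c, hpq])
    have h1 := hf4 (i, σ, τ)
    have h2 := hf4 (i, σ', τ')
    rw [← hpq] at h2
    have e1 : σ = σ' := Subtype.ext (funext fun x => by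
      have := (h1.left x).symm.trans (h2.left x)
      exact (List.append_inj' this rfl).1)
    have e2 : τ = τ' := Subtype.ext (funext fun x => by
      have := (h1.right x).symm.trans (h2.right x)
      exact (List.append_inj' this rfl).1)
    rw [e1, e2]
  refine ⟨Finset.univ.image f, ?_, ?_⟩
  · rw [Finset.card_image_of_injective _ hfi, Finset.card_univ]
    simp [sq]
  · intro τ hτ
    obtain ⟨p, -, rfl⟩ := Finset.mem_image.1 hτ
    exact ⟨hf1 p, hf2 p⟩

end Counting

/-! ### The recursion, its base case and the product formula. -/

section Binary

/-- There are at least `B` configurations of the chips in `Fin n` with at most one chip on each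
vertex that are reached with a common number of firings of the root. -/
def HasStable (n B : ℕ) : Prop :=
  ∃ (K : ℕ) (S : Finset (Config 2 (Fin n))), S.card = B ∧
    ∀ τ ∈ S, Reach K (initial 2 (Fin n)) τ ∧ Function.Injective τ

theorem HasStable.le_ncard {n B : ℕ} (h : HasStable n B) :
    B ≤ (stableConfigs 2 (Fin n)).ncard := by
  obtain ⟨K, S, rfl, hS⟩ := h
  rw [← Set.ncard_coe_finset]
  exact Set.ncard_le_ncard
    (fun τ hτ => ⟨(hS τ hτ).1.reflTransGen, isStable_of_injective (hS τ hτ).2⟩)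
    finite_stableConfigs

/-- The middle one of `2 * M + 1` chips. -/
def midChip (M : ℕ) : Fin (2 * M + 1) := ⟨M, by omega⟩

theorem isGoodSplit_Iio (M : ℕ) :
    IsGoodSplit (midChip M) M (Finset.Iio (midChip M)) (Finset.Ioi (midChip M)) := by
  have hL : (Finset.Iio (midChip M)).card = M := by simp [midChip]
  have hR : (Finset.Ioi (midChip M)).card = M := by
    simp [midChip]
    omega
  refine ⟨hL, hR, ?_, by simp, by simp, ?_, ?_, ?_, ?_⟩
  · intro x hx
    simpa using (Finset.mem_Iio.1 hx).le
  · intro c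
    simpa using lt_trichotomy c (midChip M) |>.elim (fun h => Or.inr (Or.inl h))
      (fun h => h.elim Or.inl (fun h => Or.inr (Or.inr h)))
  · intro x hx _ _ _
    simpa using hx
  · intro _ _ y hy _
    simpa using hy
  · exact reach_of_pairs (midChip M) (initial 2 _) rfl M _ _ hL hR (by simp) (by simp)
      (fun _ _ => rfl) (fun _ _ => rfl)

/-- The chips sent to the left after exchanging the chips `i + 2` and `M + 1 + j`. -/
def swapLeft (M : ℕ) (p : Fin (M - 2) × Fin (M - 2)) : Finset (Fin (2 * M + 1)) :=
  insert 0 (insert ⟨M + 1 + p.2, by omega⟩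
    ((Finset.Ioo 0 (midChip M)).erase ⟨p.1 + 2, by omega⟩))

/-- The chips sent to the right after exchanging the chips `i + 2` and `M + 1 + j`. -/
def swapRight (M : ℕ) (p : Fin (M - 2) × Fin (M - 2)) : Finset (Fin (2 * M + 1)) :=
  insert (Fin.last _) (insert ⟨p.1 + 2, by omega⟩
    ((Finset.Ioo (midChip M) (Fin.last _)).erase ⟨M + 1 + p.2, by omega⟩))

theorem mem_swapLeft {M : ℕ} {p : Fin (M - 2) × Fin (M - 2)} {c : Fin (2 * M + 1)} :
    c ∈ swapLeft M p ↔ c.val = M + 1 + p.2 ∨ (c.val < M ∧ c.val ≠ p.1 + 2) := by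
  simp only [swapLeft, midChip, Finset.mem_insert, Finset.mem_erase, Finset.mem_Ioo, Fin.ext_iff,
    Fin.lt_def, Fin.val_zero, ne_eq]
  omega

theorem mem_swapRight {M : ℕ} {p : Fin (M - 2) × Fin (M - 2)} {c : Fin (2 * M + 1)} :
    c ∈ swapRight M p ↔ c.val = p.1 + 2 ∨ (M < c.val ∧ c.val ≠ M + 1 + p.2) := by
  simp only [swapRight, midChip, Finset.mem_insert, Finset.mem_erase, Finset.mem_Ioo, Fin.ext_iff,
    Fin.lt_def, Fin.val_last, ne_eq]
  omega

theorem isGoodSplit_swap (M : ℕ) (p : Fin (M - 2) × Fin (M - 2)) :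
    IsGoodSplit (midChip M) M (swapLeft M p) (swapRight M p) := by
  have hM : 2 < M := by
    have := p.1.2
    omega
  have hA : ((Finset.Ioo 0 (midChip M)).erase ⟨p.1 + 2, by omega⟩).card = M - 2 := by
    rw [Finset.card_erase_of_mem (by simp [midChip, Fin.lt_def]; omega)]
    simp [midChip]
    omega
  have hB : ((Finset.Ioo (midChip M) (Fin.last _)).erase ⟨M + 1 + p.2, by omega⟩).card
      = M - 2 := by
    rw [Finset.card_erase_of_mem (by simp [midChip, Fin.lt_def]; omega), Fin.card_Ioo]
    simp only [midChip, Fin.val_last]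
    omega
  refine ⟨?_, ?_, ?_, ?_, ?_, ?_, ?_, ?_, ?_⟩
  · rw [swapLeft, Finset.card_insert_of_notMem, Finset.card_insert_of_notMem, hA]
    · omega
    · simp [midChip, Fin.lt_def]
      omega
    · simp only [Finset.mem_insert, Finset.mem_erase, Finset.mem_Ioo, Fin.ext_iff, Fin.lt_def,
        Fin.val_zero]
      omega
  · rw [swapRight, Finset.card_insert_of_notMem, Finset.card_insert_of_notMem, hB]
    · omega
    · simp [midChip, Fin.lt_def]
      omega
    · simp [Fin.ext_iff]
      omega
  · intro x
    rw [mem_swapLeft, mem_swapRight]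
    omega
  · rw [mem_swapLeft]
    simp [midChip]
    omega
  · rw [mem_swapRight]
    simp [midChip]
    omega
  · intro c
    rw [mem_swapLeft, mem_swapRight, Fin.ext_iff]
    simp only [midChip]
    omega
  · intro x hx y hy
    rw [mem_swapLeft] at hx hy
    simp only [midChip, Fin.lt_def]
    omega
  · intro x hx y hy
    rw [mem_swapRight] at hx hy
    simp only [midChip, Fin.lt_def]
    omega
  -- Reserving `0, 1` and `2 * M - 1, 2 * M` as auxiliary chips leaves `M - 2` choices for each
  -- exchanged chip.
  · have := reach_splitConfig_swap (n := M - 2) (a := 0) (b := (⟨1, by omega⟩ : Fin (2 * M + 1)))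
      (i := ⟨p.1 + 2, by omega⟩) (r := midChip M) (j := ⟨M + 1 + p.2, by omega⟩)
      (y := ⟨2 * M - 1, by omega⟩) (z := Fin.last _)
      (by simp [Fin.lt_def]) (by simp [Fin.lt_def]) (by simp [Fin.lt_def, midChip]; omega)
      (by simp [Fin.lt_def, midChip]; omega) (by simp [Fin.lt_def]; omega)
      (by simp [Fin.lt_def]; omega) _ _ hA hB (by simp)
      (fun x hx => (Finset.mem_Ioo.1 (Finset.mem_of_mem_erase hx)).1) (by simp) (by simp) (by simp) (by simp)
    rwa [show M - 2 + 2 = M by omega] at this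

theorem HasStable.step {M B : ℕ} (h : HasStable M B) :
    HasStable (2 * M + 1) ((1 + (M - 2) ^ 2) * B ^ 2) := by
  obtain ⟨K, S, rfl, hS⟩ := h
  let L : Option (Fin (M - 2) × Fin (M - 2)) → Finset (Fin (2 * M + 1)) :=
    fun o => o.elim (Finset.Iio (midChip M)) (swapLeft M)
  let R : Option (Fin (M - 2) × Fin (M - 2)) → Finset (Fin (2 * M + 1)) :=
    fun o => o.elim (Finset.Ioi (midChip M)) (swapRight M)
  have hg : ∀ o, IsGoodSplit (midChip M) M (L o) (R o) := by
    rintro (_ | p)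
    · exact isGoodSplit_Iio M
    · exact isGoodSplit_swap M p
  have hne : ∀ p, Finset.Iio (midChip M) ≠ swapLeft M p := by
    intro p hp
    have : (⟨p.1 + 2, by omega⟩ : Fin (2 * M + 1)) ∈ Finset.Iio (midChip M) := by
      simp [midChip, Fin.lt_def]
      omega
    rw [hp, mem_swapLeft] at this
    simp at this
    omega
  have hinj : Function.Injective L := by
    rintro (_ | p) (_ | q) hpq
    · rfl
    · exact absurd hpq (hne q)
    · exact absurd hpq.symm (hne p)
    -- `p` is determined by the one chip below `M` that is missing from `swapLeft M p` and the one
    -- chip above `M` that it contains.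
    · have h1 : (⟨p.1 + 2, by omega⟩ : Fin (2 * M + 1)) ∉ swapLeft M p := by
        rw [mem_swapLeft]
        simp
        omega
      have h2 : (⟨M + 1 + p.2, by omega⟩ : Fin (2 * M + 1)) ∈ swapLeft M p := by
        simp [mem_swapLeft]
      have e : swapLeft M p = swapLeft M q := hpq
      rw [e, mem_swapLeft] at h1 h2
      simp only at h1 h2
      have e1 : p.1 = q.1 := by ext; omega
      have e2 : p.2 = q.2 := by ext; omega
      rw [Prod.ext e1 e2]
  obtain ⟨T, hT, hT'⟩ := exists_finset_join hg hinj S hS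
  refine ⟨M + K, T, ?_, hT'⟩
  rw [hT]
  simp [sq, add_comm]

/-- The step from three chips would give only `2`. Here chips `2, 3, 4` take all six arrangements on
`[]`, `[0, 1]`, `[1, 0]`, the other chips being fixed. The root fires `4` times: three times to
split, once to return chips to its children. -/
theorem hasStable_seven : HasStable 7 6 := by
  refine ⟨4, {
    ![[0, 0], [0], [], [0, 1], [1, 0], [1], [1, 1]],
    ![[0, 0], [0], [0, 1], [], [1, 0], [1], [1, 1]],
    ![[0, 0], [0], [], [1, 0], [0, 1], [1], [1, 1]],
    ![[0, 0], [0], [0, 1], [1, 0], [], [1], [1, 1]],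
    ![[0, 0], [0], [1, 0], [], [0, 1], [1], [1, 1]],
    ![[0, 0], [0], [1, 0], [0, 1], [], [1], [1, 1]]}, by decide, ?_⟩
  simp only [Finset.forall_mem_insert, Finset.mem_singleton, forall_eq]
  refine ⟨⟨?_, by decide⟩, ⟨?_, by decide⟩, ⟨?_, by decide⟩, ⟨?_, by decide⟩, ⟨?_, by decide⟩,
    ⟨?_, by decide⟩⟩
  · exact reach_of_runFirings
      (l := [(4, 5, 6), (2, 3, 5), (0, 1, 3), (3, 5, 6), (0, 2, 4), (1, 2, 5)]) (by decide)
  · exact reach_of_runFirings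
      (l := [(4, 5, 6), (0, 1, 2), (1, 3, 5), (2, 5, 6), (0, 1, 4), (1, 3, 5)]) (by decide)
  · exact reach_of_runFirings
      (l := [(3, 4, 6), (2, 4, 5), (0, 1, 4), (4, 5, 6), (0, 2, 3), (1, 2, 5)]) (by decide)
  · exact reach_of_runFirings
      (l := [(3, 4, 6), (0, 1, 2), (1, 4, 5), (2, 5, 6), (0, 1, 3), (1, 4, 5)]) (by decide)
  · exact reach_of_runFirings
      (l := [(2, 3, 6), (1, 3, 5), (0, 3, 4), (4, 5, 6), (0, 1, 2), (1, 3, 5)]) (by decide)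
  · exact reach_of_runFirings
      (l := [(2, 3, 6), (0, 1, 3), (1, 4, 5), (3, 5, 6), (0, 1, 2), (1, 4, 5)]) (by decide)

theorem N_two (ℓ : ℕ) : N 2 ℓ = 2 ^ ℓ - 1 := by simp [N]

theorem N_two_succ (ℓ : ℕ) : N 2 (ℓ + 1) = 2 * N 2 ℓ + 1 := by
  rw [N_two, N_two, pow_succ]
  have := Nat.one_le_two_pow (n := ℓ)
  omega

theorem exists_hasStable (ℓ : ℕ) (hℓ : 3 ≤ ℓ) :
    ∃ B : ℕ, HasStable (N 2 ℓ) B ∧ (B : ℝ) = 6 ^ (2 ^ (ℓ - 3)) *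
      ∏ j ∈ Finset.Icc 4 ℓ, (1 + (((N 2 j : ℝ) - 1) / 2 - 2) ^ 2) ^ (2 ^ (ℓ - j)) := by
  induction ℓ, hℓ using Nat.le_induction with
  | base => exact ⟨6, hasStable_seven, by simp⟩
  | succ ℓ hℓ ih =>
    obtain ⟨B, hB, hB'⟩ := ih
    refine ⟨(1 + (N 2 ℓ - 2) ^ 2) * B ^ 2, ?_, ?_⟩
    · rw [N_two_succ]
      exact hB.step
    -- This makes the truncated subtraction in `N 2 ℓ - 2` agree with the real one.
    · have hN : 2 ≤ N 2 ℓ := by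
        rw [N_two]
        have := Nat.pow_le_pow_right (n := 2) (by norm_num) hℓ
        omega
      -- Squaring doubles each old exponent; the new factor `j = ℓ + 1` has exponent `1` and `(N 2
      -- (ℓ + 1) - 1) / 2 = N 2 ℓ`.
      have hprod : ∏ j ∈ Finset.Icc 4 ℓ,
            (1 + (((N 2 j : ℝ) - 1) / 2 - 2) ^ 2) ^ (2 ^ (ℓ + 1 - j)) =
          (∏ j ∈ Finset.Icc 4 ℓ,
            (1 + (((N 2 j : ℝ) - 1) / 2 - 2) ^ 2) ^ (2 ^ (ℓ - j))) ^ 2 := by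
        rw [← Finset.prod_pow]
        refine Finset.prod_congr rfl fun j hj => ?_
        rw [← pow_mul, ← pow_succ, Nat.succ_sub (Finset.mem_Icc.1 hj).2]
      rw [Finset.prod_Icc_succ_top (by omega), hprod, Nat.sub_self, pow_zero, pow_one,
        Nat.succ_sub hℓ, pow_succ 2, pow_mul, N_two_succ]
      push_cast [Nat.cast_sub hN]
      rw [hB']
      ring

end Binary

end LabeledChipFiring

theorem mainTheorem3 (ℓ : ℕ) (hℓ : 3 ≤ ℓ) :
    (LabeledChipFiring.Z 2 ℓ : ℝ) ≥
      6 ^ (2 ^ (ℓ - 3)) *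
        ∏ j ∈ Finset.Icc 4 ℓ,
          (1 + (((LabeledChipFiring.N 2 j : ℝ) - 1) / 2 - 2) ^ 2) ^ (2 ^ (ℓ - j)) := by
  obtain ⟨B, hB, hB'⟩ := LabeledChipFiring.exists_hasStable ℓ hℓ
  rw [← hB']
  exact_mod_cast hB.le_ncard
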